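/- \textbf{Setting.} Let $\mathcal N$ be a finite set of FIFO queues served by one wireless medium. Queue $n$ carries a finite nonempty set $\mathcal K_n$ of flows; the link of flow $k\in\mathcal K_n$ is ON with probability $\bar p_{n,k}\in(0,1]$ and OFF with probability $p_{n,k}=1-\bar p_{n,k}$. Let $\mathcal S=\{ON,OFF\}^{\mathcal N}$, let $1_{[ON]}=1$, $1_{[OFF]}=0$, and let $\rho_{m,k}(ON)=1$, $\rho_{m,k}(OFF)=p_{m,k}/\bar p_{m,k}$. A \emph{queue-state policy} is a family $\tau=(\tau_n(S))_{n\in\mathcal N,S\in\mathcal S}$ with $\tau_n(S)\ge 0$ and $\sum_{n}\tau_n(S)\le 1$ for all $S$. The stability region $\Lambda$ is the set of rate vectors $\lambda=(\lambda_{n,k})$ with all $\lambda_{n,k}\ge 0$ for which there is a queue-state policy $\tau$ with $$\lambda_{n,k}\le\sum_{S\in\mathcal S}\frac{\lambda_{n,k}1_{[S_n]}}{\sum_{j\in\mathcal K_n}\lambda_{n,j}/\bar p_{n,j}}\prod_{m\ne n}\psi_m(S_m)\,\tau_n(S)\quad\text{for all } n,k,\qquad(1)$$ $$\psi_m(s)=\frac{\sum_{j\in\mathcal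 K_m}\lambda_{m,j}\rho_{m,j}(s)}{\sum_{j\in\mathcal K_m}\lambda_{m,j}/\bar p_{m,j}}.$$ If queue $m$ carries no traffic ($\lambda_{m,j}=0$ for all $j$), it is never ON: $\psi_m(ON)=0$, $\psi_m(OFF)=1$, and (1) is vacuous for $n=m$. Let $\beta\ge 1$ and impose $\lambda_{n,k}=a_n\bar p_{n,k}^{\,\beta}$; write $\lambda=F_\beta(a)$. Let $\tilde\Lambda_\beta$ be the set of $a=(a_n)$ with all $a_n\ge 0$ for which there is a queue-state policy $\tau$ with $$a_n\le\sum_{S\in\mathcal S}\frac{1_{[S_n]}}{\sum_{k\in\mathcal K_n}\bar p_{n,k}^{\,\beta-1}}\prod_{m\ne n}\omega_m(S_m)\,\tau_n(S)\quad\text{for all } n,\qquad(2)$$ $$\omega_m(s)=\frac{\sum_{k\in\mathcal K_m}\bar p_{m,k}^{\,\beta}\rho_{m,k}(s)}{\sum_{k\in\mathcal K_m}\bar p_{m,k}^{\,\beta-1}},$$ and let $\tilde\Lambda_\beta^{\mathrm{pair}}$ be the set of all such pairs $(a,\tau)$. \textbf{Claim.} For every $\beta\ge1$: \begin{enumerate}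 \item If $a_n>0$ for all $n$, then for every real family $\tau$, the rates $F_\beta(a)$ satisfy (1) with $\tau$ if and only if $a$ satisfies (2) with $\tau$. \item $\tilde\Lambda_\beta^{\mathrm{pair}}$ is the solution set of finitely many linear inequalities in $(a,\tau)$; hence it is convex, and so are $\tilde\Lambda_\beta$ and the set of rates $F_\beta(\tilde\Lambda_\beta)$. \item (Inner bound) $F_\beta(\tilde\Lambda_\beta)\subseteq\Lambda$. \item (Tightness) $F_\beta(\tilde\Lambda_\beta)=\Lambda\cap\{\lambda:\lambda_{n,k}/\bar p_{n,k}^{\,\beta}=\lambda_{n,l}/\bar p_{n,l}^{\,\beta}\ \text{for all } n\in\mathcal N,\ k,l\in\mathcal K_n\}$. In particular, for $\beta=1$ the inner bound coincides with $\Lambda$ on the fairness lines $\lambda_{n,k}/\bar p_{n,k}=\lambda_{n,l}/\bar p_{n,l}$. \end{enumerate} -/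

import Mathlib

/-! Downlink network of FIFO queues sharing one wireless medium.

`N` is the finite set of queues and `K n` the finite set of flows of queue `n`.
`pbar n k` is the probability that the link of flow `k` of queue `n` is ON, and `1 - pbar n k` the
probability that it is OFF. The state of a queue is a `Bool` (`true` is ON, `false` is OFF), so the
set of joint queue states is `N → Bool`. A rate vector is `lam : ∀ n, K n → ℝ`, and a queue-state
policy is `τ : N → (N → Bool) → ℝ`, where `τ n S` is the probability that queue `n` transmits
when the joint state is `S`. -/

noncomputable section

namespace FifoNet

/-- The indicator of the ON state. -/
def onInd (s : Bool) : ℝ := if s = true then 1 else 0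

section

variable {N : Type*} {K : N → Type*}

/-- `ρ_{m,k}(ON) = 1` and `ρ_{m,k}(OFF) = p_{m,k} / pbar_{m,k}` with `p = 1 - pbar`. -/
def rho (pbar : ∀ n, K n → ℝ) (m : N) (k : K m) (s : Bool) : ℝ :=
  if s = true then 1 else (1 - pbar m k) / pbar m k

/-- The rates obtained from the parameters `a` by `λ_{n,k} = a_n * pbar_{n,k} ^ β`. -/
def fairRate (pbar : ∀ n, K n → ℝ) (β : ℝ) (a : N → ℝ) : ∀ n, K n → ℝ :=
  fun n k => a n * pbar n k ^ β

/-- The rate vectors for which `λ_{n,k} / pbar_{n,k} ^ β` does not depend on the flow `k`,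
in every queue `n`. -/
def fairnessLines (pbar : ∀ n, K n → ℝ) (β : ℝ) : Set (∀ n, K n → ℝ) :=
  {lam | ∀ n, ∀ k l : K n, lam n k / pbar n k ^ β = lam n l / pbar n l ^ β}

variable [∀ n, Fintype (K n)]

/-- The amount of wireless resource `∑_k λ_{n,k} / pbar_{n,k}` required by queue `n`. -/
def load (pbar lam : ∀ n, K n → ℝ) (n : N) : ℝ := ∑ k, lam n k / pbar n k

/-- The probability `ψ_m(s)` that queue `m` is in state `s`:
`(∑_k λ_{m,k} ρ_{m,k}(s)) / (∑_k λ_{m,k} / pbar_{m,k})`.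
For a queue that carries no traffic this quotient reads `0 / 0`; such a queue never holds a
packet, so its state is OFF with probability one. -/
def psi (pbar lam : ∀ n, K n → ℝ) (m : N) (s : Bool) : ℝ :=
  if load pbar lam m = 0 then (if s = true then 0 else 1)
  else (∑ k, lam m k * rho pbar m k s) / load pbar lam m

/-- `ω_m(s) = (∑_k pbar_{m,k} ^ β * ρ_{m,k}(s)) / ∑_k pbar_{m,k} ^ (β - 1)`. -/
def omega (pbar : ∀ n, K n → ℝ) (β : ℝ) (m : N) (s : Bool) : ℝ :=
  (∑ k, pbar m k ^ β * rho pbar m k s) / ∑ k, pbar m k ^ (β - 1)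

variable [Fintype N]

/-- Queue-state policies: nonnegative, and at most one packet is transmitted per slot. -/
def IsPolicy (τ : N → (N → Bool) → ℝ) : Prop :=
  (∀ n S, 0 ≤ τ n S) ∧ ∀ S, ∑ n, τ n S ≤ 1

variable [DecidableEq N]

/-- Every flow's arrival rate is at most its service rate under the policy `τ`. -/
def RateConstraint (pbar lam : ∀ n, K n → ℝ) (τ : N → (N → Bool) → ℝ) : Prop :=
  ∀ n, ∀ k : K n, lam n k ≤ ∑ S : N → Bool,
    lam n k * onInd (S n) / load pbar lam n
      * (∏ m ∈ Finset.univ.erase n, psi pbar lam m (S m)) * τ n S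

/-- The stability region `Λ`. -/
def stabilityRegion (pbar : ∀ n, K n → ℝ) : Set (∀ n, K n → ℝ) :=
  {lam | (∀ n k, 0 ≤ lam n k) ∧ ∃ τ, IsPolicy τ ∧ RateConstraint pbar lam τ}

/-- The constraint on the parameters `a` under the policy `τ`. -/
def FairConstraint (pbar : ∀ n, K n → ℝ) (β : ℝ) (a : N → ℝ) (τ : N → (N → Bool) → ℝ) : Prop :=
  ∀ n, a n ≤ ∑ S : N → Bool,
    onInd (S n) / (∑ k, pbar n k ^ (β - 1))
      * (∏ m ∈ Finset.univ.erase n, omega pbar β m (S m)) * τ n S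

/-- The pairs `(a, τ)` that satisfy the constraints of the inner bound. -/
def innerPairs (pbar : ∀ n, K n → ℝ) (β : ℝ) : Set ((N → ℝ) × (N → (N → Bool) → ℝ)) :=
  {x | (∀ n, 0 ≤ x.1 n) ∧ IsPolicy x.2 ∧ FairConstraint pbar β x.1 x.2}

/-- The region of the parameters `a` alone: some policy `τ` supports `a`. -/
def innerRegion (pbar : ∀ n, K n → ℝ) (β : ℝ) : Set (N → ℝ) :=
  {a | ∃ τ, (a, τ) ∈ innerPairs pbar β}

end

end FifoNet

end

/-! When `a n ≠ 0`, the factor `a n` cancels in `psi`, leaving `omega`, and `pbar n k ^ β` cancels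
from the rate constraint, so all flows of queue `n` give the same inequality. Since `omega` does not
depend on `a`, the resulting system is linear. The difficulty is an idle queue (`a m = 0`): it is
surely OFF under `psi` but random under `omega`. A policy is carried across by simulation: redraw
the idle coordinates from the other law and act on the resulting state. The result is still a
policy, and the service of every active queue is unchanged (`service_resample_redraw`). Using this
in both directions gives the inner bound and tightness. -/

namespace FifoNet

/-! ### Resampling policies by product kernels -/

section Averaging

variable {N : Type*} [Fintype N] [DecidableEq N]

/-- The service rate of queue `n` under `g`, when the other queues have state weights `w`. -/
noncomputable def service (w : N → Bool → ℝ) (c : ℝ) (n : N) (g : (N → Bool) → ℝ) : ℝ :=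
  ∑ S : N → Bool, onInd (S n) / c * (∏ m ∈ Finset.univ.erase n, w m (S m)) * g S

/-- The average of `g` when every coordinate is resampled independently by the kernel `κ`. -/
noncomputable def resample (κ : N → Bool → Bool → ℝ) (g : (N → Bool) → ℝ) (S : N → Bool) : ℝ :=
  ∑ T : N → Bool, (∏ m, κ m (S m) (T m)) * g T

/-- The kernel that redraws the coordinates in `Z` from `u` and keeps the others. -/
noncomputable def redraw (Z : N → Prop) [DecidablePred Z] (u : N → Bool → ℝ)
    (m : N) (s t : Bool) : ℝ :=
  if Z m then u m t else if s = t then 1 else 0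

theorem onInd_nonneg (s : Bool) : 0 ≤ onInd s := by
  unfold onInd; split_ifs <;> norm_num

/-- Absorbing the ON indicator as the weight of coordinate `n` lets the kernel act coordinatewise.
-/
theorem service_eq_sum_prod (w : N → Bool → ℝ) (c : ℝ) (n : N) (g : (N → Bool) → ℝ) :
    service w c n g = ∑ S : N → Bool,
      (∏ m, Function.update w n (fun s => onInd s / c) m (S m)) * g S := by
  refine Finset.sum_congr rfl fun S _ => ?_
  rw [← Finset.mul_prod_erase _ _ (Finset.mem_univ n), Function.update_self]
  congr 2
  refine Finset.prod_congr rfl fun m hm => ?_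
  rw [Function.update_of_ne (Finset.ne_of_mem_erase hm)]

theorem service_nonneg {w : N → Bool → ℝ} (hw : ∀ m s, 0 ≤ w m s) {c : ℝ} (hc : 0 ≤ c) (n : N)
    {g : (N → Bool) → ℝ} (hg : ∀ S, 0 ≤ g S) : 0 ≤ service w c n g :=
  Finset.sum_nonneg fun S _ => mul_nonneg
    (mul_nonneg (div_nonneg (onInd_nonneg _) hc) (Finset.prod_nonneg fun m _ => hw m _)) (hg S)

theorem service_congr {w w' : N → Bool → ℝ} {c : ℝ} {n : N} {g : (N → Bool) → ℝ}
    (h : ∀ m, m ≠ n → w m = w' m) : service w c n g = service w' c n g := by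
  refine Finset.sum_congr rfl fun S _ => ?_
  congr 2
  exact Finset.prod_congr rfl fun m hm => by rw [h m (Finset.ne_of_mem_erase hm)]

theorem sum_prod_eq_prod_sum (f : N → Bool → ℝ) :
    ∑ S : N → Bool, ∏ m, f m (S m) = ∏ m, ∑ s, f m s :=
  (Fintype.prod_sum f).symm

/-- After exchanging the two sums, the inner one factors over coordinates, and each factor is a
one-coordinate pushforward. -/
theorem sum_prod_mul_resample {v u : N → Bool → ℝ} {κ : N → Bool → Bool → ℝ}
    (h : ∀ m t, ∑ s, v m s * κ m s t = u m t) (g : (N → Bool) → ℝ) :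
    ∑ S : N → Bool, (∏ m, v m (S m)) * resample κ g S
      = ∑ T : N → Bool, (∏ m, u m (T m)) * g T := by
  simp only [resample, Finset.mul_sum]
  rw [Finset.sum_comm]
  refine Finset.sum_congr rfl fun T _ => ?_
  simp only [← mul_assoc, ← Finset.prod_mul_distrib, ← Finset.sum_mul]
  rw [sum_prod_eq_prod_sum fun m s => v m s * κ m s (T m)]
  simp only [h]

/-- A redrawn coordinate forgets its old state, whose law `v m` has mass one; a kept one has equal
weights on both sides. Coordinate `n` must be kept, because its weight `onInd s / c` need not have
mass one. -/
theorem service_resample_redraw {Z : N → Prop} [DecidablePred Z] {v u : N → Bool → ℝ}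
    (hv : ∀ m, ∑ s, v m s = 1) (huv : ∀ m, ¬ Z m → u m = v m) (c : ℝ) {n : N} (hn : ¬ Z n)
    (g : (N → Bool) → ℝ) :
    service v c n (resample (redraw Z u) g) = service u c n g := by
  rw [service_eq_sum_prod, service_eq_sum_prod]
  refine sum_prod_mul_resample (fun m t => ?_) g
  by_cases hm : Z m
  · have hmn : m ≠ n := fun h => hn (h ▸ hm)
    simp only [redraw, if_pos hm, Function.update_of_ne hmn, ← Finset.sum_mul, hv, one_mul]
  · have : Function.update v n (fun s => onInd s / c) m
        = Function.update u n (fun s => onInd s / c) m := by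
      by_cases hmn : m = n
      · subst hmn; simp
      · simp [Function.update_of_ne hmn, huv m hm]
    simp [redraw, hm, this]

/-- The kernel is stochastic, so each new value is a convex combination of old ones. -/
theorem IsPolicy.resample_redraw {τ : N → (N → Bool) → ℝ} (hτ : IsPolicy τ)
    (Z : N → Prop) [DecidablePred Z] {u : N → Bool → ℝ} (hu : ∀ m s, 0 ≤ u m s)
    (hu1 : ∀ m, ∑ s, u m s = 1) :
    IsPolicy fun n => resample (redraw Z u) (τ n) := by
  have hκ : ∀ m s t, 0 ≤ redraw Z u m s t := by
    intro m s t
    unfold redraw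
    split_ifs
    exacts [hu m t, zero_le_one, le_rfl]
  have hκ1 : ∀ m s, ∑ t, redraw Z u m s t = 1 := by
    intro m s
    by_cases hm : Z m
    · simp only [redraw, if_pos hm, hu1]
    · simp only [redraw, if_neg hm, Finset.sum_ite_eq, Finset.mem_univ, if_true]
  have hP : ∀ S T : N → Bool, 0 ≤ ∏ m, redraw Z u m (S m) (T m) :=
    fun S T => Finset.prod_nonneg fun m _ => hκ _ _ _
  refine ⟨fun n S => Finset.sum_nonneg fun T _ => mul_nonneg (hP S T) (hτ.1 n T), fun S => ?_⟩
  simp only [resample]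
  rw [Finset.sum_comm]
  calc ∑ T : N → Bool, ∑ n, (∏ m, redraw Z u m (S m) (T m)) * τ n T
      ≤ ∑ T : N → Bool, ∏ m, redraw Z u m (S m) (T m) := by
        refine Finset.sum_le_sum fun T _ => ?_
        rw [← Finset.mul_sum]
        exact mul_le_of_le_one_right (hP S T) (hτ.2 T)
    _ = 1 := by
        rw [sum_prod_eq_prod_sum fun m t => redraw Z u m (S m) t]
        simp only [hκ1, Finset.prod_const_one]

end Averaging

/-! ### State laws on the fairness lines -/

section Weights

variable {N : Type*} {K : N → Type*} [∀ n, Fintype (K n)] {pbar : ∀ n, K n → ℝ} {β : ℝ}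

theorem load_fairRate (hpos : ∀ n k, 0 < pbar n k) (a : N → ℝ) (n : N) :
    load pbar (fairRate pbar β a) n = a n * ∑ k, pbar n k ^ (β - 1) := by
  simp only [load, fairRate, Finset.mul_sum]
  refine Finset.sum_congr rfl fun k _ => ?_
  rw [Real.rpow_sub_one (hpos n k).ne', mul_div_assoc]

theorem psi_fairRate_of_eq_zero (hpos : ∀ n k, 0 < pbar n k) {a : N → ℝ} {m : N} (ha : a m = 0)
    (s : Bool) : psi pbar (fairRate pbar β a) m s = if s = true then 0 else 1 := by
  rw [psi, if_pos (by rw [load_fairRate hpos, ha, zero_mul])]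

theorem omega_nonneg (hpos : ∀ n k, 0 < pbar n k) (hle : ∀ n k, pbar n k ≤ 1) (m : N) (s : Bool) :
    0 ≤ omega pbar β m s := by
  refine div_nonneg (Finset.sum_nonneg fun k _ => mul_nonneg (Real.rpow_nonneg (hpos m k).le _) ?_)
    (Finset.sum_nonneg fun k _ => Real.rpow_nonneg (hpos m k).le _)
  unfold rho
  split_ifs
  · exact zero_le_one
  · exact div_nonneg (sub_nonneg.2 (hle m k)) (hpos m k).le

variable [∀ n, Nonempty (K n)]

theorem sum_rpow_pos (hpos : ∀ n k, 0 < pbar n k) (n : N) : 0 < ∑ k, pbar n k ^ (β - 1) :=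
  Finset.sum_pos (fun k _ => Real.rpow_pos_of_pos (hpos n k) _) Finset.univ_nonempty

/-- Per flow, `1 + (1 - p) / p = 1 / p`, which lowers the exponent `β` by one. -/
theorem sum_omega (hpos : ∀ n k, 0 < pbar n k) (m : N) : ∑ s, omega pbar β m s = 1 := by
  rw [Fintype.sum_bool, omega, omega, ← add_div, ← Finset.sum_add_distrib,
    div_eq_one_iff_eq (sum_rpow_pos hpos m).ne']
  refine Finset.sum_congr rfl fun k _ => ?_
  have := (hpos m k).ne'
  rw [Real.rpow_sub_one this]
  simp only [rho, if_true, Bool.false_eq_true, if_false]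
  field_simp
  ring

theorem psi_fairRate_of_ne_zero (hpos : ∀ n k, 0 < pbar n k) {a : N → ℝ} {m : N} (ha : a m ≠ 0) :
    psi pbar (fairRate pbar β a) m = omega pbar β m := by
  funext s
  rw [psi, load_fairRate hpos, if_neg (mul_ne_zero ha (sum_rpow_pos hpos m).ne')]
  simp only [fairRate, mul_assoc, ← Finset.mul_sum]
  rw [mul_div_mul_left _ _ ha, omega]

theorem psi_fairRate_nonneg (hpos : ∀ n k, 0 < pbar n k) (hle : ∀ n k, pbar n k ≤ 1) (a : N → ℝ)
    (m : N) (s : Bool) : 0 ≤ psi pbar (fairRate pbar β a) m s := by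
  by_cases ha : a m = 0
  · rw [psi_fairRate_of_eq_zero hpos ha]; split_ifs <;> norm_num
  · rw [psi_fairRate_of_ne_zero hpos ha]; exact omega_nonneg hpos hle m s

theorem sum_psi_fairRate (hpos : ∀ n k, 0 < pbar n k) (a : N → ℝ) (m : N) :
    ∑ s, psi pbar (fairRate pbar β a) m s = 1 := by
  by_cases ha : a m = 0
  · simp [psi_fairRate_of_eq_zero hpos ha]
  · simp only [psi_fairRate_of_ne_zero hpos ha, sum_omega hpos]

end Weights

/-! ### Comparison of the regions, linearity and convexity -/

section Regions

variable {N : Type*} [Fintype N] [DecidableEq N] {K : N → Type*} [∀ n, Fintype (K n)]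
  {pbar : ∀ n, K n → ℝ} {β : ℝ}

theorem fairConstraint_iff_service {a : N → ℝ} {τ : N → (N → Bool) → ℝ} :
    FairConstraint pbar β a τ ↔
      ∀ n, a n ≤ service (omega pbar β) (∑ k, pbar n k ^ (β - 1)) n (τ n) :=
  Iff.rfl

/-- For `a n = 0` both sides of the rate constraint vanish; otherwise the positive factor `pbar n k
^ β` cancels, so one flow decides for all. -/
theorem rateConstraint_fairRate_iff [∀ n, Nonempty (K n)] (hpos : ∀ n k, 0 < pbar n k)
    {a : N → ℝ} {τ : N → (N → Bool) → ℝ} :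
    RateConstraint pbar (fairRate pbar β a) τ ↔
      ∀ n, a n ≠ 0 → a n ≤ service (psi pbar (fairRate pbar β a))
        (∑ k, pbar n k ^ (β - 1)) n (τ n) := by
  have key : ∀ n, a n ≠ 0 → ∀ k : K n, (∑ S : N → Bool,
      fairRate pbar β a n k * onInd (S n) / load pbar (fairRate pbar β a) n
        * (∏ m ∈ Finset.univ.erase n, psi pbar (fairRate pbar β a) m (S m)) * τ n S)
      = service (psi pbar (fairRate pbar β a)) (∑ k, pbar n k ^ (β - 1)) n (τ n)
        * pbar n k ^ β := by
    intro n hn k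
    rw [service, Finset.sum_mul]
    refine Finset.sum_congr rfl fun S _ => ?_
    have hD := (sum_rpow_pos (β := β) hpos n).ne'
    rw [load_fairRate hpos, fairRate]
    field_simp
  constructor
  · intro h n hn
    obtain ⟨k⟩ := ‹∀ n, Nonempty (K n)› n
    have := h n k
    rw [key n hn k] at this
    exact le_of_mul_le_mul_right this (Real.rpow_pos_of_pos (hpos n k) β)
  · intro h n k
    by_cases hn : a n = 0
    · simp [fairRate, hn]
    · rw [key n hn k]
      exact mul_le_mul_of_nonneg_right (h n hn) (Real.rpow_nonneg (hpos n k).le β)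

theorem rateConstraint_fairRate_iff_fairConstraint [∀ n, Nonempty (K n)]
    (hpos : ∀ n k, 0 < pbar n k) {a : N → ℝ} (ha : ∀ n, 0 < a n) {τ : N → (N → Bool) → ℝ} :
    RateConstraint pbar (fairRate pbar β a) τ ↔ FairConstraint pbar β a τ := by
  rw [rateConstraint_fairRate_iff hpos, fairConstraint_iff_service]
  refine forall_congr' fun n => ?_
  rw [service_congr fun m _ => psi_fairRate_of_ne_zero hpos (ha m).ne']
  exact ⟨fun h => h (ha n).ne', fun h _ => h⟩

theorem fairRate_image_subset_stabilityRegion [∀ n, Nonempty (K n)]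
    (hpos : ∀ n k, 0 < pbar n k) (hle : ∀ n k, pbar n k ≤ 1) :
    fairRate pbar β '' innerRegion pbar β ⊆ stabilityRegion pbar := by
  classical
  rintro _ ⟨a, ⟨τ, ha, hτ, hf⟩, rfl⟩
  refine ⟨fun n k => mul_nonneg (ha n) (Real.rpow_nonneg (hpos n k).le β),
    -- Idle queues are really OFF; the policy invents `omega`-distributed states for them.
    fun n => resample (redraw (fun m => a m = 0) (omega pbar β)) (τ n),
    hτ.resample_redraw _ (omega_nonneg hpos hle) (sum_omega hpos),
    (rateConstraint_fairRate_iff hpos).2 fun n hn => ?_⟩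
  rw [service_resample_redraw (sum_psi_fairRate hpos a)
    (fun m hm => (psi_fairRate_of_ne_zero hpos hm).symm) _ hn]
  exact hf n

theorem mem_innerRegion_of_fairRate_mem [∀ n, Nonempty (K n)]
    (hpos : ∀ n k, 0 < pbar n k) (hle : ∀ n k, pbar n k ≤ 1) {a : N → ℝ} (ha : ∀ n, 0 ≤ a n)
    (h : fairRate pbar β a ∈ stabilityRegion pbar) : a ∈ innerRegion pbar β := by
  classical
  obtain ⟨-, τ, hτ, hr⟩ := h
  have hτ' := hτ.resample_redraw (fun m => a m = 0) (psi_fairRate_nonneg (β := β) hpos hle a)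
    (sum_psi_fairRate hpos a)
  -- Conversely, the policy treats idle queues as OFF whatever their state.
  refine ⟨fun n => resample (redraw (fun m => a m = 0) (psi pbar (fairRate pbar β a))) (τ n),
    ha, hτ', fairConstraint_iff_service.2 fun n => ?_⟩
  by_cases hn : a n = 0
  -- Here idle queues are constrained too, but only by nonnegativity of service.
  · exact hn.trans_le (service_nonneg (omega_nonneg hpos hle) (sum_rpow_pos hpos n).le n (hτ'.1 n))
  · dsimp only
    rw [service_resample_redraw (sum_omega hpos)
      (fun m hm => psi_fairRate_of_ne_zero hpos hm) _ hn]
    exact (rateConstraint_fairRate_iff hpos).1 hr n hn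

theorem fairRate_image_eq [∀ n, Nonempty (K n)]
    (hpos : ∀ n k, 0 < pbar n k) (hle : ∀ n k, pbar n k ≤ 1) :
    fairRate pbar β '' innerRegion pbar β = stabilityRegion pbar ∩ fairnessLines pbar β := by
  have hp : ∀ n k, 0 < pbar n k ^ β := fun n k => Real.rpow_pos_of_pos (hpos n k) β
  refine Set.Subset.antisymm
    (Set.subset_inter (fairRate_image_subset_stabilityRegion hpos hle) ?_) ?_
  · rintro _ ⟨a, -, rfl⟩ n k l
    simp only [fairRate]
    rw [mul_div_cancel_right₀ _ (hp n k).ne', mul_div_cancel_right₀ _ (hp n l).ne']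
  · rintro lam ⟨hs, hl⟩
    -- On the fairness lines the ratio is the same for every flow, so any choice recovers `a`.
    let k₀ : ∀ n, K n := fun n => Classical.arbitrary (K n)
    have hlam : fairRate pbar β (fun n => lam n (k₀ n) / pbar n (k₀ n) ^ β) = lam := by
      funext n k
      rw [fairRate, hl n (k₀ n) k, div_mul_cancel₀ _ (hp n k).ne']
    exact ⟨_, mem_innerRegion_of_fairRate_mem hpos hle
      (fun n => div_nonneg (hs.1 _ _) (hp _ _).le) (hlam.symm ▸ hs), hlam⟩

/-- `innerPairs` is cut out by nonnegativity of `a`, nonnegativity of `τ`, the total transmission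
bound in every state, and the service constraint of every queue. -/
theorem exists_linear_innerPairs (pbar : ∀ n, K n → ℝ) (β : ℝ) :
    ∃ (r : ℕ) (L : Fin r → ((N → ℝ) × (N → (N → Bool) → ℝ)) →ₗ[ℝ] ℝ) (c : Fin r → ℝ),
      innerPairs pbar β = {x | ∀ i, L i x ≤ c i} := by
  let pa (n : N) : ((N → ℝ) × (N → (N → Bool) → ℝ)) →ₗ[ℝ] ℝ :=
    LinearMap.proj n ∘ₗ LinearMap.fst ℝ _ _
  let pt (n : N) (S : N → Bool) : ((N → ℝ) × (N → (N → Bool) → ℝ)) →ₗ[ℝ] ℝ :=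
    LinearMap.proj S ∘ₗ LinearMap.proj n ∘ₗ LinearMap.snd ℝ _ _
  let L : N ⊕ (N × (N → Bool)) ⊕ (N → Bool) ⊕ N →
      ((N → ℝ) × (N → (N → Bool) → ℝ)) →ₗ[ℝ] ℝ :=
    Sum.elim (fun n => -pa n) <| Sum.elim (fun q => -pt q.1 q.2) <|
      Sum.elim (fun S => ∑ n, pt n S) fun n => pa n - ∑ S : N → Bool,
        (onInd (S n) / (∑ k, pbar n k ^ (β - 1))
          * (∏ m ∈ Finset.univ.erase n, omega pbar β m (S m))) • pt n S
  let c : N ⊕ (N × (N → Bool)) ⊕ (N → Bool) ⊕ N → ℝ :=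
    Sum.elim 0 <| Sum.elim 0 <| Sum.elim 1 0
  let e := Fintype.equivFin (N ⊕ (N × (N → Bool)) ⊕ (N → Bool) ⊕ N)
  refine ⟨_, L ∘ e.symm, c ∘ e.symm, Set.ext fun x => ?_⟩
  rw [Set.mem_ofPred_eq, e.symm.forall_congr_left]
  simp [innerPairs, IsPolicy, FairConstraint, L, c, pa, pt, Sum.forall, Prod.forall, and_assoc]

theorem convex_innerPairs (pbar : ∀ n, K n → ℝ) (β : ℝ) : Convex ℝ (innerPairs pbar β) := by
  obtain ⟨r, L, c, h⟩ := exists_linear_innerPairs pbar β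
  rw [h, Set.ofPred_forall]
  exact convex_iInter fun i => convex_halfSpace_le (L i).isLinear (c i)

theorem convex_innerRegion (pbar : ∀ n, K n → ℝ) (β : ℝ) : Convex ℝ (innerRegion pbar β) := by
  have h : innerRegion pbar β = LinearMap.fst ℝ _ _ '' innerPairs pbar β := by
    ext a; simp [innerRegion]
  rw [h]
  exact (convex_innerPairs pbar β).linear_image _

theorem convex_fairRate_image (pbar : ∀ n, K n → ℝ) (β : ℝ) :
    Convex ℝ (fairRate pbar β '' innerRegion pbar β) :=
  (convex_innerRegion pbar β).is_linear_image
    ⟨fun a b => by funext n k; simp [fairRate, add_mul],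
      fun r a => by funext n k; simp [fairRate, mul_assoc]⟩

end Regions

end FifoNet

theorem mainTheorem3 {N : Type*} [Fintype N] [DecidableEq N]
    {K : N → Type*} [∀ n, Fintype (K n)] [∀ n, Nonempty (K n)]
    (pbar : ∀ n, K n → ℝ) (hpos : ∀ n k, 0 < pbar n k) (hle : ∀ n k, pbar n k ≤ 1)
    (β : ℝ) (hβ : 1 ≤ β) :
    -- under the fair substitution the two systems of constraints are the same
    (∀ (a : N → ℝ) (τ : N → (N → Bool) → ℝ), (∀ n, 0 < a n) →
      (FifoNet.RateConstraint pbar (FifoNet.fairRate pbar β a) τ ↔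
        FifoNet.FairConstraint pbar β a τ)) ∧
    -- the inner region is cut out by finitely many linear inequalities in `(a, τ)`
    (∃ (r : ℕ) (L : Fin r → ((N → ℝ) × (N → (N → Bool) → ℝ)) →ₗ[ℝ] ℝ) (c : Fin r → ℝ),
      FifoNet.innerPairs pbar β = {x | ∀ i, L i x ≤ c i}) ∧
    -- it is convex, jointly in `(a, τ)`, in `a` alone, and as a set of rate vectors
    Convex ℝ (FifoNet.innerPairs pbar β) ∧
    Convex ℝ (FifoNet.innerRegion pbar β) ∧
    Convex ℝ (FifoNet.fairRate pbar β '' FifoNet.innerRegion pbar β) ∧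
    -- it is an inner bound on the stability region
    FifoNet.fairRate pbar β '' FifoNet.innerRegion pbar β ⊆ FifoNet.stabilityRegion pbar ∧
    -- it is tight on the lines it is built on
    FifoNet.fairRate pbar β '' FifoNet.innerRegion pbar β =
      FifoNet.stabilityRegion pbar ∩ FifoNet.fairnessLines pbar β ∧
    -- for exponent one, these are the lines `λ_{n,k} / pbar_{n,k} = λ_{n,l} / pbar_{n,l}`
    FifoNet.fairRate pbar 1 '' FifoNet.innerRegion pbar 1 =
      FifoNet.stabilityRegion pbar ∩
        {lam | ∀ n, ∀ k l : K n, lam n k / pbar n k = lam n l / pbar n l} := by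
  refine ⟨fun a τ ha => FifoNet.rateConstraint_fairRate_iff_fairConstraint hpos ha,
    FifoNet.exists_linear_innerPairs pbar β, FifoNet.convex_innerPairs pbar β,
    FifoNet.convex_innerRegion pbar β, FifoNet.convex_fairRate_image pbar β,
    FifoNet.fairRate_image_subset_stabilityRegion hpos hle,
    FifoNet.fairRate_image_eq hpos hle, ?_⟩
  rw [FifoNet.fairRate_image_eq hpos hle]
  simp only [FifoNet.fairnessLines, Real.rpow_one]
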